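/- Let $d,m,k$ be nonnegative integers with $m<d$ and $k\ge 2$. Let $M\subseteq\mathbb R^d$ be an $m$-dimensional $C^k$ submanifold, that is: for every $\xi\in M$ there are open sets $U,V\subseteq\mathbb R^d$ with $\xi\in U$ and a $C^k$ diffeomorphism $\Psi:V\to U$ such that, for all $y\in V$, $\Psi(y)\in M$ if and only if $y_{m+1}=\dots=y_d=0$. For $\xi\in M$ let $T_\xi(M)$ be the tangent space of $M$ at $\xi$ and $P_{T_\xi(M)}$ the orthogonal projection of $\mathbb R^d$ onto it. Let $\operatorname{unpp}(M)$ be the set of all $x\in\mathbb R^d$ for which there is exactly one $\xi\in M$ with $\|x-\xi\|=d(x,M)=\inf_{\eta\in M}\|x-\eta\|$; denote this point by $p(x)$, and let $\mathscr E(M)$ be the interior of $\operatorname{unpp}(M)$. For $\xi\in M$ and a unit vector $v\perp T_\xi(M)$, the shape operator $L_{\xi,v}:T_\xi(M)\to T_\xi(M)$ is $L_{\xi,v}:=-P_{T_\xi(M)}Dn(\xi)$, where $n:V\to\mathbb R^d$ is any $C^1$ unit normal field on an open neighborhood $V$ of $\xi$ in $M$ (i.e. $\|n(\eta)\|=1$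 and $n(\eta)\perp T_\eta(M)$ for all $\eta\in V$) with $n(\xi)=v$; it does not depend on the choice of $n$. Let $x\in\mathscr E(M)$, and put $v=\|x-p(x)\|^{-1}(x-p(x))$ if $x\notin M$ (if $x\in M$, then $x-p(x)=0$, the choice of $v$ is irrelevant, and $\|x-p(x)\|L_{p(x),v}$ is read as $0$). Then the operator $$\operatorname{id}_{T_{p(x)}(M)}-\|x-p(x)\|\,L_{p(x),v}:T_{p(x)}(M)\to T_{p(x)}(M)$$ is invertible, and $p$ is differentiable at $x$ with $$Dp(x)=\big(\operatorname{id}_{T_{p(x)}(M)}-\|x-p(x)\|\,L_{p(x),v}\big)^{-1}P_{T_{p(x)}(M)}.$$ In particular, if $x\in M$, then $Dp(x)=P_{T_x(M)}$. -/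

import Mathlib

open Set Topology

/-- Euclidean space of dimension `d`. -/
abbrev Euc (d : ℕ) : Type := EuclideanSpace ℝ (Fin d)

/-- The set of points of `ℝ^d` that have a unique nearest point on `M`. -/
def unpp {d : ℕ} (M : Set (Euc d)) : Set (Euc d) :=
  {x | ∃! ξ, ξ ∈ M ∧ ‖x - ξ‖ = Metric.infDist x M}

/-- The maximal open set on which the nearest point projection onto `M` is defined. -/
def projDomain {d : ℕ} (M : Set (Euc d)) : Set (Euc d) := interior (unpp M)

open Classical in
/-- The nearest point projection onto `M`. On `unpp M` the value is the unique nearest point;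
elsewhere the value is irrelevant. -/
noncomputable def nearestPoint {d : ℕ} (M : Set (Euc d)) (x : Euc d) : Euc d :=
  if h : ∃ ξ, ξ ∈ M ∧ ‖x - ξ‖ = Metric.infDist x M then h.choose else x

/-- `M` is an `m`-dimensional `C^k` submanifold of `ℝ^d` (with `m < d`): around each of its points
there is a `C^k` diffeomorphism `Ψ : V → U` between open subsets of `ℝ^d` such that, for `y ∈ V`,
`Ψ y ∈ M` iff the coordinates of `y` after the first `m` ones vanish. -/
def IsSubmanifold {d : ℕ} (m k : ℕ) (M : Set (Euc d)) : Prop :=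
  m < d ∧ ∀ ξ ∈ M, ∃ Ψ : OpenPartialHomeomorph (Euc d) (Euc d),
    ξ ∈ Ψ.target ∧
    ContDiffOn ℝ k Ψ Ψ.source ∧
    ContDiffOn ℝ k Ψ.symm Ψ.target ∧
    ∀ y ∈ Ψ.source, (Ψ y ∈ M ↔ ∀ i : Fin d, m ≤ (i : ℕ) → y i = 0)

/-- Velocities at `ξ` of `C^1` curves `(-1, 1) → M` through `ξ`. -/
def tangentVectors {d : ℕ} (M : Set (Euc d)) (ξ : Euc d) : Set (Euc d) :=
  {t | ∃ γ : ℝ → Euc d, ContDiffOn ℝ 1 γ (Ioo (-1) 1) ∧ (∀ s ∈ Ioo (-1 : ℝ) 1, γ s ∈ M) ∧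
    γ 0 = ξ ∧ HasDerivAt γ t 0}

/-- The tangent space `T_ξ(M)`. For a `C^k` submanifold with `k ≥ 1` the set `tangentVectors M ξ` is
already a linear subspace, so that taking the span changes nothing
(`coe_tangentSubspace` below). -/
def tangentSubspace {d : ℕ} (M : Set (Euc d)) (ξ : Euc d) : Submodule ℝ (Euc d) :=
  Submodule.span ℝ (tangentVectors M ξ)

theorem coe_tangentSubspace {d m k : ℕ} (hk : 1 ≤ k) {M : Set (Euc d)}
    (hM : IsSubmanifold m k M) {ξ : Euc d} (hξ : ξ ∈ M) :
    (tangentSubspace M ξ : Set (Euc d)) = tangentVectors M ξ := by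
  obtain ⟨-, hM⟩ := hM
  obtain ⟨Ψ, hξt, hΨ, hΨs, hiff⟩ := hM ξ hξ
  have hk1 : (1 : WithTop ℕ∞) ≤ (k : WithTop ℕ∞) := by exact_mod_cast hk
  have hk0 : (k : WithTop ℕ∞) ≠ 0 := by
    intro h
    rw [h] at hk1
    simp at hk1
  set a := Ψ.symm ξ with ha
  have has : a ∈ Ψ.source := Ψ.map_target hξt
  have hΨa : Ψ a = ξ := Ψ.right_inv hξt
  have ha0 : ∀ i : Fin d, m ≤ (i : ℕ) → a i = 0 := (hiff a has).1 (by rw [hΨa]; exact hξ)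
  have hdΨ : HasFDerivAt Ψ (fderiv ℝ Ψ a) a :=
    ((hΨ.contDiffAt (Ψ.open_source.mem_nhds has)).differentiableAt hk0).hasFDerivAt
  have hdΨs : HasFDerivAt Ψ.symm (fderiv ℝ Ψ.symm ξ) ξ :=
    ((hΨs.contDiffAt (Ψ.open_target.mem_nhds hξt)).differentiableAt hk0).hasFDerivAt
  let W : Submodule ℝ (Euc d) :=
    { carrier := {w | ∀ i : Fin d, m ≤ (i : ℕ) → w i = 0}
      zero_mem' := by intro i _; simp
      add_mem' := by
        intro u w hu hw i hi
        simp [hu i hi, hw i hi]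
      smul_mem' := by
        intro c w hw i hi
        simp [hw i hi] }
  have key : tangentVectors M ξ = (W.map (fderiv ℝ Ψ a).toLinearMap : Set (Euc d)) := by
    ext t
    constructor
    · rintro ⟨γ, -, hγM, hγ0, hγd⟩
      have hcomp : HasDerivAt (fun s => Ψ.symm (γ s)) (fderiv ℝ Ψ.symm ξ t) 0 := by
        have h1 : HasFDerivAt Ψ.symm (fderiv ℝ Ψ.symm ξ) (γ 0) := by rw [hγ0]; exact hdΨs
        exact h1.comp_hasDerivAt (0 : ℝ) hγd
      have hev : ∀ᶠ s in 𝓝 (0 : ℝ), γ s ∈ Ψ.target ∧ s ∈ Ioo (-1 : ℝ) 1 := by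
        have h1 : ∀ᶠ s in 𝓝 (0 : ℝ), γ s ∈ Ψ.target :=
          hγd.continuousAt.eventually_mem (by rw [hγ0]; exact Ψ.open_target.mem_nhds hξt)
        have h2 : ∀ᶠ s in 𝓝 (0 : ℝ), s ∈ Ioo (-1 : ℝ) 1 := Ioo_mem_nhds (by norm_num) (by norm_num)
        exact h1.and h2
      refine ⟨fderiv ℝ Ψ.symm ξ t, ?_, ?_⟩
      · intro i hi
        have hci : HasDerivAt (fun s => (Ψ.symm (γ s)) i) ((fderiv ℝ Ψ.symm ξ t) i) 0 :=
          (EuclideanSpace.proj (𝕜 := ℝ) i).hasFDerivAt.comp_hasDerivAt (0 : ℝ) hcomp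
        have hz : HasDerivAt (fun s => (Ψ.symm (γ s)) i) 0 (0 : ℝ) := by
          refine (hasDerivAt_const (0 : ℝ) (0 : ℝ)).congr_of_eventuallyEq ?_
          filter_upwards [hev] with s hs
          refine (hiff _ (Ψ.map_target hs.1)).1 ?_ i hi
          rw [Ψ.right_inv hs.1]
          exact hγM s hs.2
        exact hci.unique hz
      · have h1 : HasDerivAt (fun s => Ψ (Ψ.symm (γ s))) (fderiv ℝ Ψ a (fderiv ℝ Ψ.symm ξ t)) 0 := by
          have h2 : HasFDerivAt Ψ (fderiv ℝ Ψ a) (Ψ.symm (γ 0)) := by rw [hγ0]; exact hdΨ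
          exact h2.comp_hasDerivAt (0 : ℝ) hcomp
        have h3 : HasDerivAt (fun s => Ψ (Ψ.symm (γ s))) t 0 := by
          refine hγd.congr_of_eventuallyEq ?_
          filter_upwards [hev] with s hs
          exact Ψ.right_inv hs.1
        exact h1.unique h3
    · rintro ⟨w, hw, rfl⟩
      obtain ⟨r, hr, hball⟩ := Metric.isOpen_iff.1 Ψ.open_source a has
      obtain ⟨e, he, her⟩ : ∃ e : ℝ, 0 < e ∧ e * ‖w‖ < r := by
        refine ⟨r / (‖w‖ + 1), by positivity, ?_⟩
        rw [div_mul_eq_mul_div, div_lt_iff₀ (by positivity)]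
        nlinarith [norm_nonneg w]
      let c : ℝ → Euc d := fun s => a + (e * Real.sin (s / e)) • w
      have hcs : ∀ s, c s ∈ Ψ.source := by
        intro s
        apply hball
        rw [Metric.mem_ball, dist_eq_norm]
        have : c s - a = (e * Real.sin (s / e)) • w := by simp [c]
        rw [this, norm_smul, Real.norm_eq_abs, abs_mul, abs_of_pos he]
        have h1 := Real.abs_sin_le_one (s / e)
        have h2 : e * |Real.sin (s / e)| ≤ e * 1 := mul_le_mul_of_nonneg_left h1 he.le
        nlinarith [norm_nonneg w]
      have hcsm : ContDiff ℝ 1 c := by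
        unfold c
        fun_prop
      have hc0 : c 0 = a := by simp [c]
      have hcd : HasDerivAt c w 0 := by
        have h1 : HasDerivAt (fun s : ℝ => s / e) (1 / e) 0 := (hasDerivAt_id (0 : ℝ)).div_const e
        have h2 := ((h1.sin.const_mul e).smul_const w).const_add a
        have h3 : (e * (Real.cos (0 / e) * (1 / e))) • w = w := by simp [he.ne']
        rw [h3] at h2
        exact h2
      refine ⟨fun s => Ψ (c s), ?_, ?_, ?_, ?_⟩
      · exact ((hΨ.of_le hk1).comp hcsm.contDiffOn (fun s _ => hcs s))
      · intro s _
        refine (hiff _ (hcs s)).2 ?_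
        intro i hi
        simp [c, ha0 i hi, hw i hi]
      · simp only [hc0, hΨa]
      · have h2 : HasFDerivAt Ψ (fderiv ℝ Ψ a) (c 0) := by rw [hc0]; exact hdΨ
        exact h2.comp_hasDerivAt (0 : ℝ) hcd
  unfold tangentSubspace
  rw [key, Submodule.span_eq]

/-- `(V, n)` is a `C^1` unit normal field of `M`: `V` is open in `M` and `n : V → ℝ^d` is `C^1` with
values of norm one that are orthogonal to the tangent spaces of `M`. Only the values of `n` on `V`
matter. -/
def IsUnitNormalField {d : ℕ} (M V : Set (Euc d)) (n : Euc d → Euc d) : Prop :=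
  (∃ O : Set (Euc d), IsOpen O ∧ V = M ∩ O) ∧ ContDiffOn ℝ 1 n V ∧
    ∀ η ∈ V, ‖n η‖ = 1 ∧ n η ∈ (tangentSubspace M η)ᗮ

/-- The endomorphism `-P_{T_ξ(M)} Dn(ξ)` of `T_ξ(M)` given by a field `n` on an open subset `V` of
`M`. On `T_ξ(M)` the derivative within `V` is the derivative along curves in `M`. -/
noncomputable def shapeOfField {d : ℕ} (M V : Set (Euc d)) (n : Euc d → Euc d) (ξ : Euc d) :
    tangentSubspace M ξ →L[ℝ] tangentSubspace M ξ :=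
  -((tangentSubspace M ξ).orthogonalProjectionOnto ∘L fderivWithin ℝ n V ξ ∘L
    (tangentSubspace M ξ).subtypeL)

open Classical in
/-- The shape operator `L_{ξ,v} = -P_{T_ξ(M)} Dn(ξ)` of `M` at `ξ` in direction `v`, computed from
an arbitrary `C^1` unit normal field `(V, n)` with `ξ ∈ V` and `n ξ = v`. (On a `C^k` submanifold
with `k ≥ 2` such a field exists for each unit normal vector `v` at `ξ ∈ M`, and the operator does
not depend on its choice. If there is no such field, the value is irrelevant.) -/
noncomputable def shapeOperator {d : ℕ} (M : Set (Euc d)) (ξ v : Euc d) :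
    tangentSubspace M ξ →L[ℝ] tangentSubspace M ξ :=
  if h : ∃ q : Set (Euc d) × (Euc d → Euc d), IsUnitNormalField M q.1 q.2 ∧ ξ ∈ q.1 ∧ q.2 ξ = v
  then shapeOfField M h.choose.1 h.choose.2 ξ else 0

/-- `id - r L_{ξ,v}` on the tangent space `T_ξ(M)`. -/
noncomputable def idSubShape {d : ℕ} (M : Set (Euc d)) (ξ v : Euc d) (r : ℝ) :
    tangentSubspace M ξ →L[ℝ] tangentSubspace M ξ :=
  ContinuousLinearMap.id ℝ (tangentSubspace M ξ) - r • shapeOperator M ξ v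

/-! Write `ξ` for the nearest point `p x`, and let `N` be a normal field near `ξ` with `N ξ = x -
ξ`, namely `‖x - ξ‖` times a unit field (or `0` if `x = ξ`). Then `id - ‖x - ξ‖ L` equals `t ↦ t + P
(N' t)`, where `P` projects onto the tangent space at `ξ`.

Invertibility: since `x` is interior to `unpp M`, the segment from `ξ` to `x` extends beyond `x`
while `ξ` stays nearest (`exists_infDist_add_smul_eq`). Hence `2ρ⟪x - ξ, η - ξ⟫ ≤ ‖η - ξ‖²` on `M`
for some `ρ > 1`, and to second order along curves `‖t‖² + ρ⟪N' t, t⟫ ≥ 0`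
(`norm_sq_add_mul_inner_nonneg`). A kernel vector satisfies `‖t‖² + ⟪N' t, t⟫ = 0`, which is
compatible with `ρ > 1` only for `t = 0`.

Derivative: `y - p y` and `N (p y)` are both normal at `p y`. By continuity of `p` and of the
tangent spaces, their difference has negligible component along the tangent space at `ξ`. Expanding
`N` gives a linear equation for `P (p y - ξ)`, solved by the inverse; the normal part of `p y - ξ`
is of higher order (`hasFDerivAt_of_sub_mem_orthogonal`). -/

/-! ### Continuity of the nearest point and prolongation of normal segments -/

section NearestPoint

variable {d : ℕ} {M : Set (Euc d)} {x : Euc d}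

theorem nearestPoint_spec (hx : x ∈ unpp M) :
    nearestPoint M x ∈ M ∧ ‖x - nearestPoint M x‖ = Metric.infDist x M := by
  have h : ∃ ξ, ξ ∈ M ∧ ‖x - ξ‖ = Metric.infDist x M := ExistsUnique.exists hx
  unfold nearestPoint
  rw [dif_pos h]
  exact h.choose_spec

theorem nearestPoint_mem (hx : x ∈ unpp M) : nearestPoint M x ∈ M := (nearestPoint_spec hx).1

theorem norm_sub_nearestPoint (hx : x ∈ unpp M) :
    ‖x - nearestPoint M x‖ = Metric.infDist x M := (nearestPoint_spec hx).2

theorem eq_nearestPoint (hx : x ∈ unpp M) {ξ : Euc d} (hξ : ξ ∈ M)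
    (h : ‖x - ξ‖ = Metric.infDist x M) : ξ = nearestPoint M x :=
  ExistsUnique.unique hx ⟨hξ, h⟩ (nearestPoint_spec hx)

theorem nearestPoint_of_mem (hx : x ∈ unpp M) (hxM : x ∈ M) : nearestPoint M x = x :=
  (eq_nearestPoint hx hxM (by simp [Metric.infDist_zero_of_mem hxM])).symm

theorem projDomain_subset_unpp : projDomain M ⊆ unpp M := interior_subset

theorem infDist_le_norm_sub {η : Euc d} (hη : η ∈ closure M) : Metric.infDist x M ≤ ‖x - η‖ := by
  rw [← Metric.infDist_closure, ← dist_eq_norm]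
  exact Metric.infDist_le_dist_of_mem hη

/-- In the interior of `unpp M`, the nearest points in the closure of `M` lie in `M`: otherwise the
points slightly closer to such a point would have no nearest point in `M`. -/
theorem mem_of_mem_closure_of_norm_sub_eq (hx : x ∈ projDomain M) {q : Euc d}
    (hq : q ∈ closure M) (h : ‖x - q‖ = Metric.infDist x M) : q ∈ M := by
  by_cases hxq : x = q
  · have h0 := norm_sub_nearestPoint (projDomain_subset_unpp hx)
    rw [← h, hxq, sub_self, norm_zero, norm_eq_zero, sub_eq_zero] at h0
    rw [h0, ← hxq]
    exact nearestPoint_mem (projDomain_subset_unpp hx)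
  have hcont : Filter.Tendsto (fun s : ℝ => x + s • (q - x)) (𝓝[>] 0) (𝓝 x) := by
    have : Continuous (fun s : ℝ => x + s • (q - x)) := by fun_prop
    simpa using (this.tendsto 0).mono_left nhdsWithin_le_nhds
  have hev : ∀ᶠ s in 𝓝[>] (0 : ℝ), x + s • (q - x) ∈ unpp M ∧ s ∈ Ioo (0 : ℝ) 1 :=
    (hcont.eventually_mem (mem_interior_iff_mem_nhds.1 hx)).and
      (Ioo_mem_nhdsGT (by norm_num))
  obtain ⟨s, hs, hs0, hs1⟩ := hev.exists
  set y := x + s • (q - x) with hy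
  set ζ := nearestPoint M y
  have hζM : ζ ∈ M := nearestPoint_mem hs
  have hyq : ‖y - q‖ = (1 - s) * ‖x - q‖ := by
    have : y - q = (1 - s) • (x - q) := by rw [hy]; module
    rw [this, norm_smul, Real.norm_of_nonneg (by linarith)]
  have hxy : ‖x - y‖ = s * ‖x - q‖ := by
    have : x - y = s • (x - q) := by rw [hy]; module
    rw [this, norm_smul, Real.norm_of_nonneg hs0.le]
  have h1 : ‖y - ζ‖ ≤ (1 - s) * ‖x - q‖ := by
    rw [norm_sub_nearestPoint hs, ← hyq]
    exact infDist_le_norm_sub hq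
  have h2 : ‖x - q‖ ≤ ‖x - ζ‖ := by
    rw [h]; exact infDist_le_norm_sub (subset_closure hζM)
  have h3 : ‖x - ζ‖ ≤ ‖x - y‖ + ‖y - ζ‖ := norm_sub_le_norm_sub_add_norm_sub x y ζ
  -- Together, `h1`, `h2` and `h3` force equality in the triangle inequality, so by strict convexity
  -- `ζ` lies on the ray from `x` through `y`, at the distance of `q`.
  have h4 : ‖(x - y) + (y - ζ)‖ = ‖x - y‖ + ‖y - ζ‖ := by
    rw [sub_add_sub_cancel]; linarith
  have h5 : ‖y - ζ‖ = (1 - s) * ‖x - q‖ := by linarith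
  have h6 : SameRay ℝ (x - y) (y - ζ) := sameRay_iff_norm_add.2 h4
  have h7 := h6.norm_smul_eq
  rw [hxy, h5] at h7
  have hpos : 0 < ‖x - q‖ := norm_pos_iff.2 (sub_ne_zero.2 hxq)
  have h8 : (s * ‖x - q‖) • (q - ζ) = 0 := by
    have e : (s * ‖x - q‖) • (y - ζ) - ((1 - s) * ‖x - q‖) • (x - y) =
        (s * ‖x - q‖) • (q - ζ) := by
      rw [hy]; module
    rw [← e, h7, sub_self]
  rcases smul_eq_zero.1 h8 with h9 | h9
  · exact absurd h9 (mul_pos hs0 hpos).ne'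
  · rw [sub_eq_zero.1 h9]; exact hζM

/-- Nearest points of a convergent sequence are bounded, and a subsequential limit realises the
distance in `closure M`. As `M` need not be closed, the previous lemma is what puts this limit in
`M`; uniqueness then identifies it. -/
theorem continuousAt_nearestPoint (hx : x ∈ projDomain M) : ContinuousAt (nearestPoint M) x := by
  have hev : ∀ᶠ y in 𝓝 x, y ∈ unpp M := mem_interior_iff_mem_nhds.1 hx
  rw [ContinuousAt]
  refine Filter.tendsto_of_subseq_tendsto ?_
  intro ys hys
  have h1 : ∀ᶠ i in Filter.atTop, ys i ∈ unpp M := hys.eventually hev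
  have hdist : Filter.Tendsto (fun i => Metric.infDist (ys i) M) Filter.atTop
      (𝓝 (Metric.infDist x M)) := ((Metric.continuous_infDist_pt M).tendsto x).comp hys
  have hbd : ∀ᶠ i in Filter.atTop,
      nearestPoint M (ys i) ∈ Metric.closedBall x (Metric.infDist x M + 2) := by
    filter_upwards [h1, hdist.eventually (Iio_mem_nhds (lt_add_one _)),
      hys.eventually (Metric.ball_mem_nhds x one_pos)] with i hi hi2 hi3
    rw [Metric.mem_closedBall, dist_comm]
    have := norm_sub_nearestPoint hi
    rw [← dist_eq_norm] at this
    have h4 := dist_triangle x (ys i) (nearestPoint M (ys i))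
    have hi3 : dist (ys i) x < 1 := hi3
    rw [dist_comm] at hi3
    have hi2 : Metric.infDist (ys i) M < Metric.infDist x M + 1 := hi2
    linarith
  obtain ⟨q, -, φ, hφ, hq⟩ :=
    (isCompact_closedBall x (Metric.infDist x M + 2)).tendsto_subseq' hbd.frequently
  refine ⟨φ, ?_⟩
  have hφt := hφ.tendsto_atTop
  have hqcl : q ∈ closure M := mem_closure_of_tendsto hq
    ((hφt.eventually h1).mono fun i hi => nearestPoint_mem hi)
  have hqd : ‖x - q‖ = Metric.infDist x M := by
    refine tendsto_nhds_unique (((hys.comp hφt).sub hq).norm) ?_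
    refine (hdist.comp hφt).congr' ?_
    filter_upwards [hφt.eventually h1] with i hi
    exact (norm_sub_nearestPoint hi).symm
  rw [← eq_nearestPoint (projDomain_subset_unpp hx)
    (mem_of_mem_closure_of_norm_sub_eq hx hqcl hqd) hqd]
  exact hq

/-- The slope of the distance function in the direction away from the nearest point is one. -/
theorem exists_infDist_add_smul_gt {y : Euc d} (hy : y ∈ projDomain M)
    (hpos : 0 < Metric.infDist y M) {c : ℝ} (hc : c < 1) {O : Set (Euc d)} (hO : O ∈ 𝓝 y) :
    ∃ h, y + h ∈ O ∧ Metric.infDist y M + c * ‖h‖ < Metric.infDist (y + h) M := by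
  set δ := Metric.infDist y M
  set p := nearestPoint M
  set w := y - p y with hw
  have hwn : ‖w‖ = δ := norm_sub_nearestPoint (projDomain_subset_unpp hy)
  have hcont : Filter.Tendsto (fun s : ℝ => y + s • w) (𝓝[>] 0) (𝓝 y) := by
    have : Continuous (fun s : ℝ => y + s • w) := by fun_prop
    simpa using (this.tendsto 0).mono_left nhdsWithin_le_nhds
  -- For `s > 0` this expression is a lower bound for `s⁻¹` times `infDist (y + s • w) M ^ 2 - (δ +
  -- c * (s * δ)) ^ 2`: expand the square, use `δ ≤ ‖y - p (y + s • w)‖` and drop `(s * δ) ^ 2`. Its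
  -- limit is `2(1 - c)δ²`.
  have hlim : Filter.Tendsto
      (fun s : ℝ => 2 * inner ℝ w (y - p (y + s • w)) - s * (c * δ) ^ 2 - 2 * c * δ * δ)
      (𝓝[>] 0) (𝓝 (2 * inner ℝ w (y - p y) - 0 * (c * δ) ^ 2 - 2 * c * δ * δ)) := by
    have h1 : Filter.Tendsto (fun s : ℝ => p (y + s • w)) (𝓝[>] 0) (𝓝 (p y)) :=
      (continuousAt_nearestPoint hy).tendsto.comp hcont
    have h2 : Filter.Tendsto (fun s : ℝ => s) (𝓝[>] 0) (𝓝 0) :=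
      Filter.tendsto_id.mono_left nhdsWithin_le_nhds
    exact (((tendsto_const_nhds.inner (tendsto_const_nhds.sub h1)).const_mul 2).sub
      (h2.mul_const _)).sub_const _
  have hpos' : 0 < 2 * inner ℝ w (y - p y) - 0 * (c * δ) ^ 2 - 2 * c * δ * δ := by
    rw [← hw, real_inner_self_eq_norm_sq, hwn]
    nlinarith [mul_pos hpos hpos]
  have hev := (hlim.eventually (Ioi_mem_nhds hpos')).and ((hcont.eventually_mem hO).and
    ((hcont.eventually_mem (mem_interior_iff_mem_nhds.1 hy)).and self_mem_nhdsWithin))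
  obtain ⟨s, hs, hsO, hsu, hs0⟩ := hev.exists
  have hs0 : 0 < s := hs0
  have hs : 0 < 2 * inner ℝ w (y - p (y + s • w)) - s * (c * δ) ^ 2 - 2 * c * δ * δ := hs
  refine ⟨s • w, hsO, ?_⟩
  rw [norm_smul, Real.norm_of_nonneg hs0.le, hwn]
  refine lt_of_pow_lt_pow_left₀ 2 Metric.infDist_nonneg ?_
  rw [← norm_sub_nearestPoint hsu]
  have hle : δ ≤ ‖y - p (y + s • w)‖ := infDist_le_norm_sub (subset_closure (nearestPoint_mem hsu))
  have e : y + s • w - nearestPoint M (y + s • w) = (y - p (y + s • w)) + s • w := by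
    simp only [p]; abel
  rw [e, norm_add_sq_real, inner_smul_right, real_inner_comm, norm_smul, hwn,
    Real.norm_of_nonneg hs0.le]
  have hsq : δ ^ 2 ≤ ‖y - p (y + s • w)‖ ^ 2 := by gcongr
  nlinarith [mul_pos hs0 hs, sq_nonneg (s * δ)]

/-- The segment from the nearest point to `x` can be prolonged beyond `x`. -/
theorem exists_infDist_add_smul_eq (hx : x ∈ projDomain M) (hpos : 0 < Metric.infDist x M) :
    ∃ ρ : ℝ, 1 < ρ ∧
      Metric.infDist (nearestPoint M x + ρ • (x - nearestPoint M x)) M =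
        ρ * ‖x - nearestPoint M x‖ := by
  set δ := Metric.infDist x M with hδ
  set ξ := nearestPoint M x with hξ
  have hxu := projDomain_subset_unpp hx
  have hxξ : ‖x - ξ‖ = δ := norm_sub_nearestPoint hxu
  obtain ⟨e, he, hball⟩ : ∃ e > 0, Metric.closedBall x e ⊆ projDomain M ∩ Metric.ball x δ :=
    Metric.nhds_basis_closedBall.mem_iff.1
      (Filter.inter_mem (isOpen_interior.mem_nhds hx) (Metric.ball_mem_nhds x hpos))
  have hposball : ∀ y ∈ Metric.closedBall x e, 0 < Metric.infDist y M := by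
    intro y hy
    have h1 := (hball hy).2
    rw [Metric.mem_ball, dist_comm] at h1
    have := Metric.infDist_le_infDist_add_dist (s := M) (x := x) (y := y)
    linarith
  have hcpt := isCompact_closedBall x e
  have hne : (Metric.closedBall x e).Nonempty := ⟨x, Metric.mem_closedBall_self he.le⟩
  obtain ⟨z, hz, hzmax⟩ := hcpt.exists_isMaxOn hne
    (Metric.continuous_infDist_pt M).continuousOn
  -- A maximiser of `infDist y M - c * dist y x` on the ball cannot be interior, since from there
  -- the distance to `M` would grow at a rate above `c`. So it lies on the sphere; letting `c → 1`,
  -- the distance to `M` attains `δ + e`.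
  have hbound : ∀ c ∈ Ioo (0 : ℝ) 1, δ + c * e ≤ Metric.infDist z M := by
    intro c hc
    obtain ⟨y, hy, hymax⟩ := hcpt.exists_isMaxOn (f := fun y => Metric.infDist y M - c * dist y x)
      hne ((Metric.continuous_infDist_pt M).sub
        (continuous_const.mul (continuous_id.dist continuous_const))).continuousOn
    have hye : dist y x = e := by
      by_contra hcon
      have hlt : dist y x < e := lt_of_le_of_ne hy hcon
      obtain ⟨h, hh, hgt⟩ := exists_infDist_add_smul_gt (hball hy).1 (hposball y hy) hc.2
        (Metric.isOpen_ball.mem_nhds hlt)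
      have h1 := hymax (Metric.ball_subset_closedBall hh)
      have h2 : dist (y + h) x ≤ ‖h‖ + dist y x := by
        refine (dist_triangle _ y _).trans_eq ?_
        rw [dist_eq_norm (y + h), add_sub_cancel_left]
      have h1 : Metric.infDist (y + h) M - c * dist (y + h) x ≤
        Metric.infDist y M - c * dist y x := h1
      nlinarith [mul_le_mul_of_nonneg_left h2 hc.1.le]
    have h1 : Metric.infDist x M - c * dist x x ≤ Metric.infDist y M - c * dist y x :=
      hymax (Metric.mem_closedBall_self he.le)
    have h2 : Metric.infDist y M ≤ Metric.infDist z M := hzmax hy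
    rw [hye, dist_self] at h1
    linarith
  have hze : δ + e ≤ Metric.infDist z M := by
    have hl : Filter.Tendsto (fun c : ℝ => δ + c * e) (𝓝[<] 1) (𝓝 (δ + 1 * e)) := by
      have : Continuous (fun c : ℝ => δ + c * e) := by fun_prop
      exact (this.tendsto 1).mono_left nhdsWithin_le_nhds
    rw [one_mul] at hl
    refine le_of_tendsto hl ?_
    filter_upwards [Ioo_mem_nhdsLT (zero_lt_one' ℝ)] with c hc using hbound c hc
  have hzx : ‖z - x‖ ≤ e := by rw [← dist_eq_norm]; exact hz
  have hzξ : Metric.infDist z M ≤ ‖z - ξ‖ :=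
    infDist_le_norm_sub (subset_closure (nearestPoint_mem hxu))
  have htri : ‖z - ξ‖ ≤ ‖z - x‖ + ‖x - ξ‖ := norm_sub_le_norm_sub_add_norm_sub z x ξ
  have hzx' : ‖z - x‖ = e := by linarith
  -- The bound `δ + e` is also the largest the triangle inequality allows, so `ξ`, `x`, `z` are
  -- aligned.
  have hray : SameRay ℝ (z - x) (x - ξ) := by
    rw [sameRay_iff_norm_add, sub_add_sub_cancel]; linarith
  have h7 := hray.norm_smul_eq
  rw [hzx', hxξ] at h7
  have hzeq : z = ξ + (1 + e / δ) • (x - ξ) := by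
    have : z - x = (e / δ) • (x - ξ) := by
      rw [div_eq_inv_mul, mul_smul, h7, smul_smul, inv_mul_cancel₀ hpos.ne', one_smul]
    rw [← sub_add_cancel z x, this]; module
  refine ⟨1 + e / δ, by have := div_pos he hpos; linarith, ?_⟩
  rw [← hzeq, hxξ]
  have : (1 + e / δ) * δ = δ + e := by field_simp
  rw [this]
  linarith

/-- The open ball about the prolonged point with `nearestPoint M x` on its boundary misses `M`;
expanding the square gives the inequality. The strict `1 < ρ` is what later excludes a kernel. -/
theorem exists_one_lt_inner_le (hx : x ∈ projDomain M) :
    ∃ ρ : ℝ, 1 < ρ ∧ ∀ η ∈ M, 2 * ρ * inner ℝ (x - nearestPoint M x) (η - nearestPoint M x) ≤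
      ‖η - nearestPoint M x‖ ^ 2 := by
  have hxu := projDomain_subset_unpp hx
  rcases (Metric.infDist_nonneg (x := x) (s := M)).eq_or_lt with h0 | hpos
  · refine ⟨2, by norm_num, fun η _ => ?_⟩
    rw [← norm_sub_nearestPoint hxu, eq_comm, norm_eq_zero] at h0
    rw [h0, inner_zero_left, mul_zero]
    positivity
  · obtain ⟨ρ, hρ, h⟩ := exists_infDist_add_smul_eq hx hpos
    refine ⟨ρ, hρ, fun η hη => ?_⟩
    set ξ := nearestPoint M x
    have h1 : ρ * ‖x - ξ‖ ≤ ‖ρ • (x - ξ) - (η - ξ)‖ := by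
      rw [← h]
      have e : ρ • (x - ξ) - (η - ξ) = ξ + ρ • (x - ξ) - η := by abel
      rw [e]
      exact infDist_le_norm_sub (subset_closure hη)
    have h2 : (ρ * ‖x - ξ‖) ^ 2 ≤ ‖ρ • (x - ξ) - (η - ξ)‖ ^ 2 := by gcongr
    rw [norm_sub_sq_real, norm_smul, Real.norm_of_nonneg (by linarith), inner_smul_left] at h2
    simp only [conj_trivial] at h2
    linarith

end NearestPoint

/-! ### Tangent spaces and normal fields through flattening charts -/

section Tangent

variable {d : ℕ} {M : Set (Euc d)}

/-- An affine reparametrisation moves the time `s` to `0` and keeps the interval `(-1, 1)` required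
by `tangentVectors`. -/
theorem deriv_mem_tangentSubspace {γ : ℝ → Euc d} (hγ : ContDiffOn ℝ 1 γ (Ioo (-1) 1))
    (hγM : ∀ s ∈ Ioo (-1 : ℝ) 1, γ s ∈ M) {s : ℝ} (hs : s ∈ Ioo (-1 : ℝ) 1) :
    deriv γ s ∈ tangentSubspace M (γ s) := by
  obtain ⟨e, he, he1, he2⟩ : ∃ e : ℝ, 0 < e ∧ s + e ≤ 1 ∧ -1 ≤ s - e :=
    ⟨min (1 - s) (1 + s), lt_min (by linarith [hs.2]) (by linarith [hs.1]),
      by linarith [min_le_left (1 - s) (1 + s)], by linarith [min_le_right (1 - s) (1 + s)]⟩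
  have hmaps : ∀ τ ∈ Ioo (-1 : ℝ) 1, s + e * τ ∈ Ioo (-1 : ℝ) 1 := by
    intro τ hτ
    constructor <;> nlinarith [hτ.1, hτ.2]
  have hd : HasDerivAt γ (deriv γ s) (s + e * 0) := by
    rw [mul_zero, add_zero]
    exact ((hγ.contDiffAt (Ioo_mem_nhds hs.1 hs.2)).differentiableAt one_ne_zero).hasDerivAt
  have haff : HasDerivAt (fun τ : ℝ => s + e * τ) e 0 := by
    simpa using ((hasDerivAt_id (0 : ℝ)).const_mul e).const_add s
  have hmem : e • deriv γ s ∈ tangentSubspace M (γ s) := by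
    refine Submodule.subset_span ⟨fun τ => γ (s + e * τ), ?_, fun τ hτ => hγM _ (hmaps τ hτ),
      by simp, ?_⟩
    · exact hγ.comp (by fun_prop) hmaps
    · exact hd.scomp (0 : ℝ) haff
  have := Submodule.smul_mem _ e⁻¹ hmem
  rwa [smul_smul, inv_mul_cancel₀ he.ne', one_smul] at this

/-- First-order condition: along a curve in `M` through `ξ`, the squared distance to `x` is minimal
at time `0`. -/
theorem sub_mem_orthogonal_of_forall_norm_le {x ξ : Euc d} (h : ∀ η ∈ M, ‖x - ξ‖ ≤ ‖x - η‖) :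
    x - ξ ∈ (tangentSubspace M ξ)ᗮ := by
  rw [tangentSubspace, Submodule.mem_orthogonal]
  intro t ht
  induction ht using Submodule.span_induction with
  | zero => simp
  | add a b _ _ ha hb => rw [inner_add_left, ha, hb, add_zero]
  | smul c a _ ha => rw [inner_smul_left, ha, mul_zero]
  | mem t ht =>
    obtain ⟨γ, -, hγM, hγ0, hγd⟩ := ht
    have h1 := (hγd.const_sub x).norm_sq
    have hmin : IsLocalMin (fun s => ‖x - γ s‖ ^ 2) 0 := by
      have : ∀ᶠ s in 𝓝 (0 : ℝ), s ∈ Ioo (-1 : ℝ) 1 := Ioo_mem_nhds (by norm_num) (by norm_num)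
      filter_upwards [this] with s hs
      have := h _ (hγM s hs)
      rw [hγ0]
      gcongr
    have h2 := hmin.hasDerivAt_eq_zero h1
    rw [hγ0, inner_neg_right] at h2
    rw [real_inner_comm]
    linarith

/-- The coordinate subspace of vectors whose coordinates after the first `m` ones vanish. -/
def coordSubspace (d m : ℕ) : Submodule ℝ (Euc d) where
  carrier := {w | ∀ i : Fin d, m ≤ (i : ℕ) → w i = 0}
  zero_mem' := by intro i _; simp
  add_mem' := by
    intro u w hu hw i hi
    simp [hu i hi, hw i hi]
  smul_mem' := by
    intro c w hw i hi
    simp [hw i hi]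

/-- `Ψ` is a `C^2` diffeomorphism between open sets that flattens `M`. -/
structure IsFlatteningChart (m : ℕ) (M : Set (Euc d))
    (Ψ : OpenPartialHomeomorph (Euc d) (Euc d)) : Prop where
  contDiffOn : ContDiffOn ℝ 2 Ψ Ψ.source
  contDiffOn_symm : ContDiffOn ℝ 2 Ψ.symm Ψ.target
  mem_iff : ∀ y ∈ Ψ.source, (Ψ y ∈ M ↔ y ∈ coordSubspace d m)

theorem IsSubmanifold.exists_isFlatteningChart {m k : ℕ} (hk : 2 ≤ k) (hM : IsSubmanifold m k M)
    {ξ : Euc d} (hξ : ξ ∈ M) :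
    ∃ Ψ : OpenPartialHomeomorph (Euc d) (Euc d), ξ ∈ Ψ.target ∧ IsFlatteningChart m M Ψ := by
  obtain ⟨Ψ, h1, h2, h3, h4⟩ := hM.2 ξ hξ
  have hk' : (2 : WithTop ℕ∞) ≤ (k : WithTop ℕ∞) := by exact_mod_cast hk
  exact ⟨Ψ, h1, h2.of_le hk', h3.of_le hk', h4⟩

namespace IsFlatteningChart

variable {m : ℕ} {Ψ : OpenPartialHomeomorph (Euc d) (Euc d)} {η : Euc d}

theorem hasFDerivAt_symm (h : IsFlatteningChart m M Ψ) (hη : η ∈ Ψ.target) :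
    HasFDerivAt Ψ.symm (fderiv ℝ Ψ.symm η) η :=
  ((h.contDiffOn_symm.contDiffAt (Ψ.open_target.mem_nhds hη)).differentiableAt
    two_ne_zero).hasFDerivAt

theorem hasFDerivAt (h : IsFlatteningChart m M Ψ) {b : Euc d} (hb : b ∈ Ψ.source) :
    HasFDerivAt Ψ (fderiv ℝ Ψ b) b :=
  ((h.contDiffOn.contDiffAt (Ψ.open_source.mem_nhds hb)).differentiableAt
    two_ne_zero).hasFDerivAt

theorem symm_mem (h : IsFlatteningChart m M Ψ) (hη : η ∈ Ψ.target) (hηM : η ∈ M) :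
    Ψ.symm η ∈ coordSubspace d m :=
  (h.mem_iff _ (Ψ.map_target hη)).1 (by rwa [Ψ.right_inv hη])

theorem fderiv_comp_fderiv_symm (h : IsFlatteningChart m M Ψ) (hη : η ∈ Ψ.target) :
    fderiv ℝ Ψ (Ψ.symm η) ∘L fderiv ℝ Ψ.symm η = ContinuousLinearMap.id ℝ (Euc d) := by
  have h1 := (h.hasFDerivAt (Ψ.map_target hη)).comp η (h.hasFDerivAt_symm hη)
  refine h1.unique ((hasFDerivAt_id η).congr_of_eventuallyEq ?_)
  filter_upwards [Ψ.open_target.mem_nhds hη] with y hy using Ψ.right_inv hy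

theorem fderiv_symm_mem (h : IsFlatteningChart m M Ψ) (hη : η ∈ Ψ.target)
    {t : Euc d} (ht : t ∈ tangentSubspace M η) :
    fderiv ℝ Ψ.symm η t ∈ coordSubspace d m := by
  have hle : tangentSubspace M η ≤
      (coordSubspace d m).comap (fderiv ℝ Ψ.symm η).toLinearMap := by
    refine Submodule.span_le.2 ?_
    rintro t ⟨γ, -, hγM, hγ0, hγd⟩ i hi
    have hcomp : HasDerivAt (fun s => Ψ.symm (γ s)) (fderiv ℝ Ψ.symm η t) 0 := by
      have h1 : HasFDerivAt Ψ.symm (fderiv ℝ Ψ.symm η) (γ 0) := by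
        rw [hγ0]; exact h.hasFDerivAt_symm hη
      exact h1.comp_hasDerivAt (0 : ℝ) hγd
    have hci : HasDerivAt (fun s => (Ψ.symm (γ s)) i) ((fderiv ℝ Ψ.symm η t) i) 0 :=
      (EuclideanSpace.proj (𝕜 := ℝ) i).hasFDerivAt.comp_hasDerivAt (0 : ℝ) hcomp
    refine hci.unique ((hasDerivAt_const (0 : ℝ) (0 : ℝ)).congr_of_eventuallyEq ?_)
    have h1 : ∀ᶠ s in 𝓝 (0 : ℝ), γ s ∈ Ψ.target :=
      hγd.continuousAt.eventually_mem (by rw [hγ0]; exact Ψ.open_target.mem_nhds hη)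
    have h2 : ∀ᶠ s in 𝓝 (0 : ℝ), s ∈ Ioo (-1 : ℝ) 1 := Ioo_mem_nhds (by norm_num) (by norm_num)
    filter_upwards [h1, h2] with s hs1 hs2
    exact h.symm_mem hs1 (hγM s hs2) i hi
  exact hle ht

theorem fderiv_mem (h : IsFlatteningChart m M Ψ) (hη : η ∈ Ψ.target) (hηM : η ∈ M)
    {w : Euc d} (hw : w ∈ coordSubspace d m) :
    fderiv ℝ Ψ (Ψ.symm η) w ∈ tangentSubspace M η := by
  set a := Ψ.symm η with ha
  have has : a ∈ Ψ.source := Ψ.map_target hη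
  obtain ⟨r, hr, hball⟩ := Metric.isOpen_iff.1 Ψ.open_source a has
  obtain ⟨e, he, her⟩ : ∃ e : ℝ, 0 < e ∧ e * ‖w‖ < r := by
    refine ⟨r / (‖w‖ + 1), by positivity, ?_⟩
    rw [div_mul_eq_mul_div, div_lt_iff₀ (by positivity)]
    nlinarith [norm_nonneg w]
  have hcs : ∀ s ∈ Ioo (-1 : ℝ) 1, a + (e * s) • w ∈ Ψ.source := by
    intro s hs
    apply hball
    rw [Metric.mem_ball, dist_eq_norm, add_sub_cancel_left, norm_smul, Real.norm_eq_abs, abs_mul,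
      abs_of_pos he]
    have h2 : e * |s| ≤ e * 1 := mul_le_mul_of_nonneg_left (abs_lt.2 hs).le he.le
    nlinarith [norm_nonneg w]
  have hcd : HasDerivAt (fun s : ℝ => a + (e * s) • w) (e • w) 0 := by
    simpa using ((((hasDerivAt_id (0 : ℝ)).const_mul e).smul_const w).const_add a)
  have hmem : e • fderiv ℝ Ψ a w ∈ tangentSubspace M η := by
    refine Submodule.subset_span ⟨fun s => Ψ (a + (e * s) • w), ?_, ?_, ?_, ?_⟩
    · exact (h.contDiffOn.of_le one_le_two).comp (by fun_prop) hcs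
    · intro s hs
      exact (h.mem_iff _ (hcs s hs)).2
        (Submodule.add_mem _ (h.symm_mem hη hηM) (Submodule.smul_mem _ _ hw))
    · simp [ha, Ψ.right_inv hη]
    · have h2 : HasFDerivAt Ψ (fderiv ℝ Ψ a) (a + (e * 0) • w) := by
        simpa using h.hasFDerivAt has
      rw [← map_smul]
      exact h2.comp_hasDerivAt (0 : ℝ) hcd
  have := Submodule.smul_mem _ e⁻¹ hmem
  rwa [smul_smul, inv_mul_cancel₀ he.ne', one_smul] at this

theorem target_mem_nhdsWithin (hη : η ∈ Ψ.target) :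
    ∀ᶠ y in 𝓝[M] η, y ∈ Ψ.target ∧ y ∈ M :=
  Filter.Eventually.and (mem_nhdsWithin_of_mem_nhds (Ψ.open_target.mem_nhds hη))
    self_mem_nhdsWithin

/-- Secants of `M` at `η` are tangent to first order. -/
theorem isLittleO_starProjection_orthogonal (h : IsFlatteningChart m M Ψ) (hη : η ∈ Ψ.target)
    (hηM : η ∈ M) :
    (fun y => (tangentSubspace M η)ᗮ.starProjection (y - η)) =o[𝓝[M] η] fun y => y - η := by
  set B := fderiv ℝ Ψ (Ψ.symm η)
  set A := fderiv ℝ Ψ.symm η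
  have h1 : (fun y => Ψ.symm y - Ψ.symm η - A (y - η)) =o[𝓝[M] η] fun y => y - η :=
    (h.hasFDerivAt_symm hη).hasFDerivWithinAt.isLittleO
  -- Since `B ∘ A = id`, applying `-B` to the remainder gives `y - η` minus `B` of a vector in the
  -- coordinate subspace; the latter is tangent and vanishes under the normal projection.
  have h2 := (((tangentSubspace M η)ᗮ.starProjection ∘L (-B)).isBigO_comp
    (fun y => Ψ.symm y - Ψ.symm η - A (y - η)) (𝓝[M] η)).trans_isLittleO h1
  refine h2.congr' ?_ Filter.EventuallyEq.rfl
  filter_upwards [target_mem_nhdsWithin hη] with y hy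
  have h3 : B (Ψ.symm y - Ψ.symm η) ∈ tangentSubspace M η :=
    h.fderiv_mem hη hηM (Submodule.sub_mem _ (h.symm_mem hy.1 hy.2) (h.symm_mem hη hηM))
  have h4 : B (A (y - η)) = y - η :=
    DFunLike.congr_fun (h.fderiv_comp_fderiv_symm hη) (y - η)
  have h5 : (tangentSubspace M η)ᗮ.starProjection (B (Ψ.symm y - Ψ.symm η)) = 0 := by
    rw [Submodule.starProjection_apply_eq_zero_iff]
    exact Submodule.le_orthogonal_orthogonal _ h3
  simp only [ContinuousLinearMap.comp_apply, neg_apply, map_sub B _ (A _), h4,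
    map_neg, map_sub _ (B _) (y - η), h5]
  simp

/-- The tangent spaces of `M` depend continuously on the base point. -/
theorem exists_continuousAt_tangent_transport (h : IsFlatteningChart m M Ψ)
    (hη : η ∈ Ψ.target) :
    ∃ C : Euc d → Euc d →L[ℝ] Euc d, ContinuousAt C η ∧ C η = ContinuousLinearMap.id ℝ (Euc d) ∧
      ∀ᶠ y in 𝓝[M] η, ∀ t ∈ tangentSubspace M η, C y t ∈ tangentSubspace M y := by
  refine ⟨fun y => fderiv ℝ Ψ (Ψ.symm y) ∘L fderiv ℝ Ψ.symm η, ?_,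
    h.fderiv_comp_fderiv_symm hη, ?_⟩
  · have h1 : ContinuousAt (fderiv ℝ Ψ) (Ψ.symm η) :=
      (h.contDiffOn.continuousOn_fderiv_of_isOpen Ψ.open_source one_le_two).continuousAt
        (Ψ.open_source.mem_nhds (Ψ.map_target hη))
    have h2 : ContinuousAt (fun y => fderiv ℝ Ψ (Ψ.symm y)) η :=
      ContinuousAt.comp (f := Ψ.symm) h1 (Ψ.symm.continuousAt hη)
    exact h2.clm_comp continuousAt_const
  · filter_upwards [target_mem_nhdsWithin hη] with y hy t ht
    exact h.fderiv_mem hy.1 hy.2 (h.fderiv_symm_mem hη ht)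

/-- Adjoints of the chart derivatives transport normals: `v` is pulled back to a vector `w`
orthogonal to the coordinate subspace, and the adjoint of `D(Ψ⁻¹)(y)` sends `w` to a normal at `y`.
One derivative of the `C^2` chart is spent, so the field is `C^1`; it is normalised where it is
nonzero. -/
theorem exists_isUnitNormalField (h : IsFlatteningChart m M Ψ) (hη : η ∈ Ψ.target) (hηM : η ∈ M)
    {v : Euc d} (hv : ‖v‖ = 1) (hvT : v ∈ (tangentSubspace M η)ᗮ) :
    ∃ q : Set (Euc d) × (Euc d → Euc d), IsUnitNormalField M q.1 q.2 ∧ η ∈ q.1 ∧ q.2 η = v := by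
  set w : Euc d := ContinuousLinearMap.adjoint (fderiv ℝ Ψ (Ψ.symm η)) v with hw
  have hwW : ∀ u ∈ coordSubspace d m, inner ℝ u w = 0 := by
    intro u hu
    rw [hw, ContinuousLinearMap.adjoint_inner_right]
    exact Submodule.mem_orthogonal _ _ |>.1 hvT _ (h.fderiv_mem hη hηM hu)
  set N : Euc d → Euc d := fun y => ContinuousLinearMap.adjoint (fderiv ℝ Ψ.symm y) w with hN
  have hNη : N η = v := by
    refine ext_inner_left ℝ fun u => ?_
    rw [hN, ContinuousLinearMap.adjoint_inner_right, hw, ContinuousLinearMap.adjoint_inner_right]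
    exact congrArg (fun z => inner ℝ z v) (DFunLike.congr_fun (h.fderiv_comp_fderiv_symm hη) u)
  have hNd : ContDiffOn ℝ 1 N Ψ.target := by
    rw [contDiffOn_euclidean]
    intro i
    have h1 : ContDiffOn ℝ 1 (fderiv ℝ Ψ.symm) Ψ.target :=
      h.contDiffOn_symm.fderiv_of_isOpen Ψ.open_target (by norm_num)
    have h2 : ∀ y, N y i = inner ℝ (fderiv ℝ Ψ.symm y (EuclideanSpace.single i 1)) w := by
      intro y
      rw [← ContinuousLinearMap.adjoint_inner_right, EuclideanSpace.inner_single_left]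
      simp [hN]
    simp only [h2]
    exact (h1.clm_apply contDiffOn_const).inner ℝ contDiffOn_const
  have hOopen : IsOpen (Ψ.target ∩ N ⁻¹' {0}ᶜ) :=
    hNd.continuousOn.isOpen_inter_preimage Ψ.open_target isOpen_compl_singleton
  have hv0 : v ≠ 0 := by
    rintro rfl
    simp at hv
  refine ⟨(M ∩ (Ψ.target ∩ N ⁻¹' {0}ᶜ), fun y => ‖N y‖⁻¹ • N y), ⟨⟨_, hOopen, rfl⟩, ?_, ?_⟩,
    ⟨hηM, hη, ?_⟩, ?_⟩
  · have h1 : ContDiffOn ℝ 1 N (M ∩ (Ψ.target ∩ N ⁻¹' {0}ᶜ)) := hNd.mono fun y hy => hy.2.1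
    exact ((h1.norm ℝ fun y hy => hy.2.2).inv fun y hy => norm_ne_zero_iff.2 hy.2.2).smul h1
  · intro y hy
    refine ⟨norm_smul_inv_norm (𝕜 := ℝ) hy.2.2, Submodule.smul_mem _ _ ?_⟩
    rw [Submodule.mem_orthogonal]
    intro t ht
    rw [hN, ContinuousLinearMap.adjoint_inner_right]
    exact hwW _ (h.fderiv_symm_mem hy.2.1 ht)
  · simpa [hNη] using hv0
  · simp [hNη, hv]

end IsFlatteningChart

end Tangent

/-! ### Second-order condition and differentiation of the nearest point -/

section Derivative

variable {d : ℕ} {M : Set (Euc d)} {ξ : Euc d} {N : Euc d → Euc d} {N' : Euc d →L[ℝ] Euc d}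

/-- The second order necessary condition at a nearest point, in terms of a normal field. -/
theorem norm_sq_add_mul_inner_nonneg (hN : HasFDerivWithinAt N N' M ξ)
    (hNT : ∀ᶠ η in 𝓝[M] ξ, N η ∈ (tangentSubspace M η)ᗮ) {ρ : ℝ}
    (hρ : ∀ η ∈ M, 2 * ρ * inner ℝ (N ξ) (η - ξ) ≤ ‖η - ξ‖ ^ 2)
    {t : Euc d} (ht : t ∈ tangentVectors M ξ) : 0 ≤ ‖t‖ ^ 2 + ρ * inner ℝ (N' t) t := by
  obtain ⟨γ, hγ, hγM, hγ0, hγd⟩ := ht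
  have hI : Ioo (-1 : ℝ) 1 ∈ 𝓝 (0 : ℝ) := Ioo_mem_nhds (by norm_num) (by norm_num)
  have hγd' : ∀ s ∈ Ioo (-1 : ℝ) 1, HasDerivAt γ (deriv γ s) s := fun s hs =>
    ((hγ.contDiffAt (Ioo_mem_nhds hs.1 hs.2)).differentiableAt one_ne_zero).hasDerivAt
  set φ : ℝ → ℝ := fun s => ‖γ s - ξ‖ ^ 2 - 2 * ρ * inner ℝ (N ξ) (γ s - ξ) with hφ
  set φ' : ℝ → ℝ := fun s =>
    2 * inner ℝ (γ s - ξ) (deriv γ s) - 2 * ρ * inner ℝ (N ξ) (deriv γ s) with hφ'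
  have hφd : ∀ s ∈ Ioo (-1 : ℝ) 1, HasDerivAt φ (φ' s) s := by
    intro s hs
    have h1 := (hγd' s hs).sub_const ξ
    have h2 := (hasDerivAt_const s (N ξ)).inner ℝ h1
    rw [inner_zero_left, add_zero] at h2
    exact h1.norm_sq.sub (h2.const_mul (2 * ρ))
  -- `γ` is only `C^1`, so a second derivative of `φ` is not available. The mean value theorem with
  -- `φ 0 = 0 ≤ φ σ` gives `φ' ≥ 0` at times arbitrarily close to `0`, which suffices.
  have hfreq : ∃ᶠ s in 𝓝[>] (0 : ℝ), 0 ≤ φ' s := by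
    rw [(nhdsGT_basis (0 : ℝ)).frequently_iff]
    intro e he
    set σ := min (e / 2) (1 / 2) with hσ
    have hσ0 : 0 < σ := lt_min (half_pos he) (by norm_num)
    have hσe : σ < e := (min_le_left _ _).trans_lt (half_lt_self he)
    have hσ1 : σ < 1 := (min_le_right _ _).trans_lt (by norm_num)
    have hsub : ∀ s ∈ Icc 0 σ, s ∈ Ioo (-1 : ℝ) 1 := fun s hs =>
      ⟨by linarith [hs.1], hs.2.trans_lt hσ1⟩
    obtain ⟨c, hc, hceq⟩ := exists_hasDerivAt_eq_slope φ φ' hσ0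
      (fun s hs => (hφd s (hsub s hs)).continuousAt.continuousWithinAt)
      (fun s hs => hφd s (hsub s (Ioo_subset_Icc_self hs)))
    refine ⟨c, ⟨hc.1, hc.2.trans hσe⟩, ?_⟩
    have h0 : φ 0 = 0 := by simp [hφ, hγ0]
    have h1 : 0 ≤ φ σ := sub_nonneg.2 (hρ _ (hγM σ (hsub σ ⟨hσ0.le, le_rfl⟩)))
    rw [hceq, h0, sub_zero, sub_zero]
    positivity
  have hNγ : HasDerivAt (fun s => N (γ s)) (N' t) 0 := by
    have h1 : HasFDerivWithinAt N N' M (γ 0) := by rwa [hγ0]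
    exact (h1.comp_hasDerivWithinAt (0 : ℝ) (hγd.hasDerivWithinAt (s := Ioo (-1) 1))
      hγM).hasDerivAt hI
  have hderiv : Filter.Tendsto (deriv γ) (𝓝[>] 0) (𝓝 t) := by
    have h1 : ContinuousAt (deriv γ) 0 :=
      (hγ.continuousOn_deriv_of_isOpen isOpen_Ioo le_rfl).continuousAt hI
    rw [← hγd.deriv]
    exact h1.tendsto.mono_left nhdsWithin_le_nhds
  have hslope : ∀ {f : ℝ → Euc d} {f' : Euc d}, HasDerivAt f f' 0 →
      Filter.Tendsto (fun s => s⁻¹ • (f s - f 0)) (𝓝[>] 0) (𝓝 f') := by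
    intro f f' hf
    have h1 := (hasDerivAt_iff_tendsto_slope.1 hf).mono_left
      (nhdsWithin_mono (0 : ℝ) fun s (hs : 0 < s) => hs.ne')
    refine h1.congr fun s => ?_
    rw [slope_def_module, sub_zero]
  have hlim : Filter.Tendsto (fun s => inner ℝ
      (s⁻¹ • (γ s - γ 0) + ρ • s⁻¹ • (N (γ s) - N (γ 0))) (deriv γ s)) (𝓝[>] 0)
      (𝓝 (inner ℝ (t + ρ • N' t) t)) :=
    ((hslope hγd).add ((hslope hNγ).const_smul ρ)).inner hderiv
  have hγw : Filter.Tendsto γ (𝓝[>] 0) (𝓝[M] ξ) := by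
    refine tendsto_nhdsWithin_iff.2 ⟨?_, ?_⟩
    · rw [← hγ0]
      exact hγd.continuousAt.tendsto.mono_left nhdsWithin_le_nhds
    · filter_upwards [mem_nhdsWithin_of_mem_nhds hI] with s hs using hγM s hs
  -- As `N (γ s)` is orthogonal to `γ' s`, the term `⟪N ξ, γ' s⟫` may be replaced by `-⟪N (γ s) - N
  -- ξ, γ' s⟫`; only difference quotients of `γ` and `N ∘ γ` then remain.
  have hev : ∀ᶠ s in 𝓝[>] (0 : ℝ), inner ℝ
      (s⁻¹ • (γ s - γ 0) + ρ • s⁻¹ • (N (γ s) - N (γ 0))) (deriv γ s) = (2 * s)⁻¹ * φ' s := by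
    filter_upwards [hγw.eventually hNT, mem_nhdsWithin_of_mem_nhds hI, self_mem_nhdsWithin]
      with s hs hsI hs0
    have h1 : inner ℝ (N (γ s)) (deriv γ s) = 0 := by
      rw [real_inner_comm]
      exact (Submodule.mem_orthogonal _ _).1 hs _ (deriv_mem_tangentSubspace hγ hγM hsI)
    have hs0 : s ≠ 0 := (show 0 < s from hs0).ne'
    simp only [hφ', hγ0, inner_add_left, real_inner_smul_left, inner_sub_left, h1]
    field_simp
    ring
  have hge : 0 ≤ inner ℝ (t + ρ • N' t) t := by
    refine ge_of_tendsto_of_frequently hlim ?_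
    refine ((hfreq.and_eventually hev).and_eventually self_mem_nhdsWithin).mono ?_
    rintro s ⟨⟨h1, h2⟩, h3⟩
    have h3 : 0 < s := h3
    rw [h2]
    positivity
  rwa [inner_add_left, real_inner_smul_left, real_inner_self_eq_norm_sq] at hge

/-- A first order expansion of the nearest point from the orthogonality relations. -/
theorem hasFDerivAt_of_sub_mem_orthogonal {m : ℕ} {Ψ : OpenPartialHomeomorph (Euc d) (Euc d)}
    (hΨ : IsFlatteningChart m M Ψ) (hξ : ξ ∈ Ψ.target) {x : Euc d} {p : Euc d → Euc d}
    (hpx : p x = ξ) (hp : ContinuousAt p x) (hpM : ∀ᶠ y in 𝓝 x, p y ∈ M)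
    (hpT : ∀ᶠ y in 𝓝 x, y - p y ∈ (tangentSubspace M (p y))ᗮ)
    (hN : HasFDerivWithinAt N N' M ξ) (hNξ : N ξ = x - ξ)
    (hNT : ∀ᶠ η in 𝓝[M] ξ, N η ∈ (tangentSubspace M η)ᗮ)
    (g : tangentSubspace M ξ ≃L[ℝ] tangentSubspace M ξ)
    (hg : ∀ t, g t = t + (tangentSubspace M ξ).orthogonalProjectionOnto (N' t)) :
    HasFDerivAt p ((tangentSubspace M ξ).subtypeL ∘L (g.symm : _ →L[ℝ] _) ∘L
      (tangentSubspace M ξ).orthogonalProjectionOnto) x := by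
  have hξM : ξ ∈ M := hpx ▸ hpM.self_of_nhds
  set π := (tangentSubspace M ξ).orthogonalProjectionOnto
  set S := (tangentSubspace M ξ).subtypeL ∘L (g.symm : _ →L[ℝ] _) ∘L π with hS
  -- No Lipschitz bound on `p` is known yet, so errors are measured against `b`, which includes `‖p
  -- y - ξ‖`; `hby` removes this term at the end.
  set b : Euc d → ℝ := fun y => ‖y - x‖ + ‖p y - ξ‖ with hb
  have hpw : Filter.Tendsto p (𝓝 x) (𝓝[M] ξ) :=
    tendsto_nhdsWithin_iff.2 ⟨hpx ▸ hp.tendsto, hpM⟩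
  have hyb : (fun y => y - x) =O[𝓝 x] b := Asymptotics.IsBigO.of_norm_le fun y => by
    simp only [hb]; linarith [norm_nonneg (p y - ξ)]
  have hzb : (fun y => p y - ξ) =O[𝓝 x] b := Asymptotics.IsBigO.of_norm_le fun y => by
    simp only [hb]; linarith [norm_nonneg (y - x)]
  have hNb : (fun y => N (p y) - N ξ - N' (p y - ξ)) =o[𝓝 x] b :=
    (hN.isLittleO.comp_tendsto hpw).trans_isBigO hzb
  have hTb : (fun y => (tangentSubspace M ξ)ᗮ.starProjection (p y - ξ)) =o[𝓝 x] b :=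
    ((hΨ.isLittleO_starProjection_orthogonal hξ hξM).comp_tendsto hpw).trans_isBigO hzb
  obtain ⟨C, hC, hCξ, hCT⟩ := hΨ.exists_continuousAt_tangent_transport hξ
  set u : Euc d → Euc d := fun y => y - p y - N (p y) with hu
  have hueq : ∀ y, u y = (y - x) - (p y - ξ) - N' (p y - ξ) - (N (p y) - N ξ - N' (p y - ξ)) := by
    intro y
    simp only [hu, hNξ]
    abel
  have hub : u =O[𝓝 x] b := by
    refine (((hyb.sub hzb).sub ((N'.isBigO_comp _ _).trans hzb)).sub hNb.isBigO).congr_left ?_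
    exact fun y => (hueq y).symm
  -- `u y` is normal at `p y`, hence orthogonal to `C (p y) (π (u y))`. Thus `‖π (u y)‖²` equals
  -- `⟪(id - C (p y)) (π (u y)), u y⟫`, and `C (p y) → id`.
  have hπu : (fun y => π (u y)) =o[𝓝 x] b := by
    have h1 : Filter.Tendsto (fun y => ‖ContinuousLinearMap.id ℝ (Euc d) - C (p y)‖) (𝓝 x)
        (𝓝 0) := by
      have h2 : Filter.Tendsto (fun y => C (p y)) (𝓝 x) (𝓝 (C ξ)) :=
        hC.tendsto.comp (hpw.mono_right nhdsWithin_le_nhds)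
      simpa [hCξ] using (h2.const_sub (ContinuousLinearMap.id ℝ (Euc d))).norm
    have h2 : (fun y => ‖ContinuousLinearMap.id ℝ (Euc d) - C (p y)‖ * ‖u y‖) =o[𝓝 x]
        fun y => (1 : ℝ) * b y :=
      ((Asymptotics.isLittleO_one_iff ℝ).2 h1).mul_isBigO hub.norm_left
    simp only [one_mul] at h2
    refine (Asymptotics.IsBigO.of_bound 1 ?_).trans_isLittleO h2
    filter_upwards [hpw.eventually hCT, hpw.eventually hNT, hpT] with y hy1 hy2 hy3
    have h3 : inner ℝ (C (p y) (π (u y))) (u y) = 0 :=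
      (Submodule.mem_orthogonal _ _).1 (Submodule.sub_mem _ hy3 hy2) _ (hy1 _ (π (u y)).2)
    have h4 : ‖π (u y)‖ ^ 2 =
        inner ℝ ((ContinuousLinearMap.id ℝ (Euc d) - C (p y)) (π (u y))) (u y) := by
      rw [sub_apply, inner_sub_left, h3, sub_zero,
        ContinuousLinearMap.id_apply, ← real_inner_self_eq_norm_sq]
      exact (Submodule.inner_orthogonalProjectionOnto_eq_of_mem_left (π (u y)) (u y))
    have h5 : ‖π (u y)‖ ^ 2 ≤
        ‖ContinuousLinearMap.id ℝ (Euc d) - C (p y)‖ * ‖π (u y)‖ * ‖u y‖ := by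
      rw [h4]
      refine (real_inner_le_norm _ _).trans ?_
      gcongr
      exact ContinuousLinearMap.le_opNorm _ _
    rw [one_mul, Real.norm_of_nonneg (by positivity)]
    rcases (norm_nonneg (π (u y))).eq_or_lt with h6 | h6
    · rw [← h6]; positivity
    · refine le_of_mul_le_mul_right ?_ h6
      linarith
  have hπ : (fun y => π (y - x) - g (π (p y - ξ))) =o[𝓝 x] b := by
    have h1 := (hπu.add ((π.isBigO_comp _ _).trans_isLittleO hNb)).add
      (((π ∘L N').isBigO_comp _ _).trans_isLittleO hTb)
    refine h1.congr_left fun y => ?_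
    have h2 : p y - ξ = (π (p y - ξ) : Euc d) + (tangentSubspace M ξ)ᗮ.starProjection (p y - ξ) :=
      (Submodule.starProjection_add_starProjection_orthogonal (p y - ξ) (K := tangentSubspace M ξ)).symm
    have h3 : π (N' (p y - ξ)) =
        π (N' (π (p y - ξ))) + π (N' ((tangentSubspace M ξ)ᗮ.starProjection (p y - ξ))) := by
      conv_lhs => rw [h2]
      rw [map_add, map_add]
    rw [hueq, hg]
    simp only [map_sub π (_ - _ - _), map_sub π (_ - _) (N' _), map_sub π (y - x),
      ContinuousLinearMap.comp_apply, h3]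
    abel
  have hz : (fun y => p y - ξ - S (y - x)) =o[𝓝 x] b := by
    have h1 := hTb.sub ((((tangentSubspace M ξ).subtypeL ∘L (g.symm : _ →L[ℝ] _)).isBigO_comp _ _).trans_isLittleO hπ)
    refine h1.congr_left fun y => ?_
    have h2 : p y - ξ = (π (p y - ξ) : Euc d) + (tangentSubspace M ξ)ᗮ.starProjection (p y - ξ) :=
      (Submodule.starProjection_add_starProjection_orthogonal (p y - ξ) (K := tangentSubspace M ξ)).symm
    have h3 : ((tangentSubspace M ξ).subtypeL ∘L (g.symm : _ →L[ℝ] _)) (π (y - x) - g (π (p y - ξ))) =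
        S (y - x) - π (p y - ξ) := by
      simp [hS]
    rw [h3]
    nth_rewrite 3 [h2]
    abel
  -- Absorption: with error at most `b / 2`, `b ≤ ‖y - x‖ + ‖S‖‖y - x‖ + b / 2`.
  have hby : b =O[𝓝 x] fun y => y - x := by
    refine Asymptotics.IsBigO.of_bound (2 * ‖S‖ + 2) ?_
    filter_upwards [hz.bound (half_pos one_pos)] with y hy
    have h1 : ‖p y - ξ‖ ≤ ‖p y - ξ - S (y - x)‖ + ‖S (y - x)‖ := by
      simpa using norm_add_le (p y - ξ - S (y - x)) (S (y - x))
    have h2 := S.le_opNorm (y - x)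
    have h3 : ‖b y‖ = ‖y - x‖ + ‖p y - ξ‖ := Real.norm_of_nonneg (by positivity)
    rw [h3] at hy ⊢
    linarith
  rw [hasFDerivAt_iff_isLittleO, hpx]
  exact hz.trans_isBigO hby

/-- Unpacks the field chosen inside `shapeOperator` and scales it by `‖x - ξ‖`, so independence of
the choice is never needed. For `x = ξ` the zero field serves. -/
theorem exists_normalField {m : ℕ} {Ψ : OpenPartialHomeomorph (Euc d) (Euc d)}
    (hΨ : IsFlatteningChart m M Ψ) (hξ : ξ ∈ Ψ.target) (hξM : ξ ∈ M) {x v : Euc d}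
    (hxT : x - ξ ∈ (tangentSubspace M ξ)ᗮ) (hv : x ≠ ξ → v = ‖x - ξ‖⁻¹ • (x - ξ)) :
    ∃ (N : Euc d → Euc d) (N' : Euc d →L[ℝ] Euc d), HasFDerivWithinAt N N' M ξ ∧ N ξ = x - ξ ∧
      (∀ᶠ η in 𝓝[M] ξ, N η ∈ (tangentSubspace M η)ᗮ) ∧
      ∀ t : tangentSubspace M ξ, idSubShape M ξ v ‖x - ξ‖ t =
        t + (tangentSubspace M ξ).orthogonalProjectionOnto (N' t) := by
  by_cases hxξ : x = ξ
  · refine ⟨fun _ => 0, 0, hasFDerivWithinAt_const _ _ _, by simp [hxξ], by simp, fun t => ?_⟩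
    simp [idSubShape, hxξ]
  have hv := hv hxξ
  have hx0 : x - ξ ≠ 0 := sub_ne_zero.2 hxξ
  have hex := hΨ.exists_isUnitNormalField hξ hξM (v := v)
    (by rw [hv]; exact norm_smul_inv_norm (𝕜 := ℝ) hx0)
    (by rw [hv]; exact Submodule.smul_mem _ _ hxT)
  have hL : shapeOperator M ξ v = shapeOfField M hex.choose.1 hex.choose.2 ξ := by
    unfold shapeOperator
    rw [dif_pos hex]
  obtain ⟨⟨⟨O, hO, hVO⟩, hn, hnT⟩, hξV, hnξ⟩ := hex.choose_spec
  set V := hex.choose.1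
  set n := hex.choose.2
  have hOξ : O ∈ 𝓝 ξ := hO.mem_nhds (by rw [hVO] at hξV; exact hξV.2)
  have hnd : HasFDerivWithinAt n (fderivWithin ℝ n V ξ) M ξ := by
    have h1 := (hn.differentiableOn one_ne_zero ξ hξV).hasFDerivWithinAt
    refine h1.mono_of_mem_nhdsWithin ?_
    rw [hVO]
    exact Filter.inter_mem self_mem_nhdsWithin (mem_nhdsWithin_of_mem_nhds hOξ)
  refine ⟨fun y => ‖x - ξ‖ • n y, ‖x - ξ‖ • fderivWithin ℝ n V ξ, hnd.fun_const_smul _, ?_, ?_, ?_⟩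
  · simp only [hnξ, hv, smul_smul, mul_inv_cancel₀ (norm_ne_zero_iff.2 hx0), one_smul]
  · filter_upwards [mem_nhdsWithin_of_mem_nhds hOξ, self_mem_nhdsWithin] with y hy hyM
    exact Submodule.smul_mem _ _ (hnT y (by rw [hVO]; exact ⟨hyM, hy⟩)).2
  · intro t
    simp [idSubShape, hL, shapeOfField]

end Derivative

/-! ### Invertibility and the derivative formula -/

theorem theorem3 {d m k : ℕ} (hk : 2 ≤ k) (M : Set (Euc d)) (hM : IsSubmanifold m k M)
    (x : Euc d) (hx : x ∈ projDomain M)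
    (v : Euc d) (hv : x ∉ M → v = ‖x - nearestPoint M x‖⁻¹ • (x - nearestPoint M x)) :
    (idSubShape M (nearestPoint M x) v ‖x - nearestPoint M x‖).IsInvertible ∧
    HasFDerivAt (nearestPoint M)
      ((tangentSubspace M (nearestPoint M x)).subtypeL ∘L
        (idSubShape M (nearestPoint M x) v ‖x - nearestPoint M x‖).inverse ∘L
        (tangentSubspace M (nearestPoint M x)).orthogonalProjectionOnto) x ∧
    (x ∈ M → HasFDerivAt (nearestPoint M) (tangentSubspace M x).starProjection x) := by
  have hxu := projDomain_subset_unpp hx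
  have hξM := nearestPoint_mem hxu
  have hT : ∀ y ∈ unpp M, y - nearestPoint M y ∈ (tangentSubspace M (nearestPoint M y))ᗮ :=
    fun y hy => sub_mem_orthogonal_of_forall_norm_le fun η hη => by
      rw [norm_sub_nearestPoint hy]
      exact infDist_le_norm_sub (subset_closure hη)
  obtain ⟨Ψ, hξ, hΨ⟩ := hM.exists_isFlatteningChart hk hξM
  obtain ⟨N, N', hN, hNξ, hNT, hg⟩ := exists_normalField hΨ hξ hξM (v := v) (hT x hxu) fun h =>
    hv fun hxM => h (nearestPoint_of_mem hxu hxM).symm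
  obtain ⟨ρ, hρ1, hρ⟩ := exists_one_lt_inner_le hx
  have hinj : Function.Injective (idSubShape M (nearestPoint M x) v ‖x - nearestPoint M x‖) := by
    refine (injective_iff_map_eq_zero _).2 fun t ht => ?_
    rw [hg] at ht
    have h1 : 0 ≤ ‖(t : Euc d)‖ ^ 2 + ρ * inner ℝ (N' t) (t : Euc d) := by
      refine norm_sq_add_mul_inner_nonneg hN hNT (by rwa [hNξ]) ?_
      rw [← coe_tangentSubspace (one_le_two.trans hk) hM hξM]
      exact t.2
    have h2 : ‖(t : Euc d)‖ ^ 2 + inner ℝ (N' t) (t : Euc d) = 0 := by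
      have h3 := congrArg (fun s => inner ℝ t s) ht
      simp only [inner_add_right, inner_zero_right, real_inner_self_eq_norm_sq,
        Submodule.inner_orthogonalProjectionOnto_eq_of_mem_left] at h3
      rw [real_inner_comm]
      exact h3
    -- Substituting `h2` into `h1` gives `(1 - ρ)‖t‖² ≥ 0` with `ρ > 1`.
    have h3 : ‖(t : Euc d)‖ ^ 2 ≤ 0 := by nlinarith [sq_nonneg ‖(t : Euc d)‖]
    have h4 : ‖(t : Euc d)‖ = 0 := by nlinarith [norm_nonneg (t : Euc d)]
    exact norm_eq_zero.1 h4
  set g := (LinearEquiv.ofInjectiveEndo _ hinj).toContinuousLinearEquiv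
  have hgeq : (g : _ →L[ℝ] _) = idSubShape M (nearestPoint M x) v ‖x - nearestPoint M x‖ := by
    ext t
    rfl
  have hinv : (idSubShape M (nearestPoint M x) v ‖x - nearestPoint M x‖).IsInvertible :=
    ⟨g, hgeq⟩
  have hev : ∀ᶠ y in 𝓝 x, y ∈ unpp M := mem_interior_iff_mem_nhds.1 hx
  have hD := hasFDerivAt_of_sub_mem_orthogonal hΨ hξ rfl (continuousAt_nearestPoint hx)
    (hev.mono fun y hy => nearestPoint_mem hy) (hev.mono hT) hN hNξ hNT g
    (fun t => (DFunLike.congr_fun hgeq t).trans (hg t))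
  rw [← ContinuousLinearMap.inverse_equiv, hgeq] at hD
  refine ⟨hinv, hD, fun hxM => ?_⟩
  have hid : idSubShape M (nearestPoint M x) v ‖x - nearestPoint M x‖ =
      ContinuousLinearMap.id ℝ _ := by
    ext t
    simp [idSubShape, nearestPoint_of_mem hxu hxM]
  rw [hid, ContinuousLinearMap.inverse_id, ContinuousLinearMap.id_comp] at hD
  have hD' : HasFDerivAt (nearestPoint M)
      (tangentSubspace M (nearestPoint M x)).starProjection x := hD
  rwa [nearestPoint_of_mem hxu hxM] at hD'
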